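/- Consider an agent with horizon $T\ge 1$ and dynamics $x_{k+1}=A_kx_k+B_ku_k+C_kd_k$, $x_0=\bar x_0+\bar d_0$, with $x_k\in\mathbb R^{n_x}$, $u_k\in\mathbb R^{n_u}$, $d_k\in\mathbb R^{n_d}$, disturbance sequence $\zeta=[\bar d_0;d_0;\dots;d_{T-1}]$ in the ellipsoid $\langle S\zeta,\zeta\rangle\le\tau$ ($S\succ0$, $\tau>0$), and purified state feedback $u_k=\bar u_k+\sum_{\ell=\max(0,k-\gamma_h+1)}^{k}K_{k,\ell}\delta_\ell$ of history length $\gamma_h$, where $\delta_{k+1}=A_k\delta_k+C_kd_k$, $\delta_0=\bar d_0$. At each time $k=1,\dots,T$ the agent must keep its position $Hx_k\in\mathbb R^m$ away from $n_{\rm obs}$ obstacles and from $n_{\rm inter}$ neighbors (agents of the same dimensions), for all admissible disturbances. In each round of consensus ADMM it solves a local subproblem whose objective is the control effort $\bar u^{\rm T}R_{\bar u}\bar u+\|R_KK\|_F^2$ plus the linear and quadratic consensus terms, in one of two forms. (SDP framework.) Variables: $(\bar u,K)$ of the agent and local copies of those of its neighbors, and one multiplier $\beta$ per time and obstacle or neighbor.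 Constraints: $\beta\ge0$ and, for each time and each obstacle or neighbor, the S-lemma linear matrix inequality of the collision constraint $\|d+G\zeta\|_2^2\ge c^2$ linearized at the nominal control parameters, of size $n_x+Tn_d+1$ for an obstacle and $2(n_x+Tn_d)+1$ for a neighbor (disturbances of both agents, one multiplier). (Proposed SOCP framework.) Variables: $(\bar u,K)$ of the agent, its bounds $\mu_{d,k}\in\mathbb R^m$, copies of $\mu^j_{d,k}$ and of the disturbance-free mean positions of its neighbors $j$, and a slack $\tilde c$ per time and obstacle or neighbor. With $c$ the required clearance, the constraints for each time are $\|\mu_{d,k}\|_2\le\tilde c-c$ (each obstacle), $\|\mu_{d,k}+\mu^j_{d,k}\|_2\le\tilde c-c$ (each neighbor), $\tau^{1/2}\|M^{\rm T}h_{k,i}\|_{S^{-1}}\le(\mu_{d,k})_i$ ($i\le m$; $M\zeta$ is the effect of $\zeta$ on the mean trajectory and $h_{k,i}^{\rm T}M\zeta$ that on the $i$-th position coordinate at time $k$), and the linearizations of $\|\text{position}-\text{obstacle or neighbor position}\|_2\ge\tilde c$. Let the problem be solved by a path-following logarithmic-barrier interior point method that makes one damped Newton step per iteration, the Newton system being solved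 by QR with Givens rotations; the constant Hessian of the quadratic objective is supplied in triangular factored form. Let $L_{\rm IP}$ be the number of iterations, and let the cost be the number of real arithmetic operations. Assume $n_x,n_u,n_d,\gamma_h,n_{\rm inter}+n_{\rm obs}\ge1$ and $n_x\le\kappa\,Tn_d$. (i) If moreover $n_d\le\kappa\,(n_{\rm inter}+n_{\rm obs})\,n_u n_x\gamma_h$ (for instance $n_d\le\kappa n_x$), the local subproblem of the SDP framework costs at most $$C\,L_{\rm IP}\,T^5(n_{\rm inter}+n_{\rm obs})^3n_u^2n_x^2n_d^2\gamma_h^2,$$ where $C$ depends only on $\kappa$. (ii) The local subproblem of the proposed framework costs at most $$C\,L_{\rm IP}\,T^4(n_{\rm inter}+n_{\rm obs})^3n_u^2n_x^2n_d\gamma_h^2,$$ where $C$ depends only on $\kappa$ and $m$. -/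

import Mathlib

open scoped Matrix BigOperators

noncomputable section

/-! ## Counting arithmetic operations -/

/-- A computed value together with the number of real arithmetic operations (additions,
subtractions, multiplications, divisions, square roots, zero tests) spent on it. Storing and
reading numbers and handling indices is free, as in the usual flop count. -/
structure Counted (α : Type) where
  val : α
  ops : ℕ

namespace Counted

instance : Monad Counted where
  pure a := ⟨a, 0⟩
  bind x f := ⟨(f x.val).val, x.ops + (f x.val).ops⟩

def add (a b : ℝ) : Counted ℝ := ⟨a + b, 1⟩
def sub (a b : ℝ) : Counted ℝ := ⟨a - b, 1⟩
def mul (a b : ℝ) : Counted ℝ := ⟨a * b, 1⟩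
def div (a b : ℝ) : Counted ℝ := ⟨a / b, 1⟩
def sqrt (a : ℝ) : Counted ℝ := ⟨Real.sqrt a, 1⟩
def isZero (a : ℝ) : Counted Prop := ⟨a = 0, 1⟩

/-- Compute and store all entries of an array. -/
def vec {n : ℕ} {α : Type} (f : Fin n → Counted α) : Counted (Fin n → α) :=
  ⟨fun i => (f i).val, ∑ i, (f i).ops⟩

/-- Compute `n` terms and add them up, with one addition per term. -/
def sum {n : ℕ} (f : Fin n → Counted ℝ) : Counted ℝ :=
  ⟨∑ i, (f i).val, ∑ i, ((f i).ops + 1)⟩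

/-- Inner product. -/
def dot {n : ℕ} (u v : Fin n → ℝ) : Counted ℝ := sum fun i => mul (u i) (v i)

/-- Product of matrices. -/
def matMul {p q r : ℕ} (A : Fin p → Fin q → ℝ) (B : Fin q → Fin r → ℝ) :
    Counted (Fin p → Fin r → ℝ) :=
  vec fun i => vec fun j => dot (A i) fun k => B k j

/-- Cholesky factorization `X = L Lᵀ`, column by column (`L` lower triangular). -/
def cholesky {p : ℕ} (X : Fin p → Fin p → ℝ) : Counted (Fin p → Fin p → ℝ) :=
  (List.finRange p).foldlM
    (fun L j => do
      let s ← dot (L j) (L j)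
      let e ← sub (X j j) s
      let d ← sqrt e
      let col ← vec fun i =>
        if i < j then pure 0
        else if i = j then pure d
        else do
          let s' ← dot (L i) (L j)
          let e' ← sub (X i j) s'
          div e' d
      pure fun i k => if k = j then col i else L i k)
    (fun _ _ => 0)

/-- Inverse of a lower triangular matrix by forward substitution, row by row. -/
def invLower {p : ℕ} (L : Fin p → Fin p → ℝ) : Counted (Fin p → Fin p → ℝ) :=
  (List.finRange p).foldlM
    (fun G i => do
      let row ← vec fun c => do
        let s ← dot (L i) fun k => G k c
        let e ← sub (if i = c then 1 else 0) s
        div e (L i i)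
      pure (Function.update G i row))
    (fun _ _ => 0)

open Classical in
/-- Given an upper triangular `R` and a row `r`, compute by Givens rotations the upper triangular
`R'` with `R'ᵀ R' = Rᵀ R + rᵀ r`. -/
def insertRow {n : ℕ} (R : Fin n → Fin n → ℝ) (r : Fin n → ℝ) :
    Counted (Fin n → Fin n → ℝ) := do
  let out ← (List.finRange n).foldlM
    (fun (S : (Fin n → Fin n → ℝ) × (Fin n → ℝ)) j => do
      let a2 ← mul (S.1 j j) (S.1 j j)
      let b2 ← mul (S.2 j) (S.2 j)
      let h2 ← add a2 b2
      let h ← sqrt h2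
      let z ← isZero h
      if z then pure S
      else do
        let c ← div (S.1 j j) h
        let s ← div (S.2 j) h
        let Rj ← vec fun k => do
          let e₁ ← mul c (S.1 j k)
          let e₂ ← mul s (S.2 k)
          add e₁ e₂
        let rj ← vec fun k => do
          let e₁ ← mul c (S.2 k)
          let e₂ ← mul s (S.1 j k)
          sub e₁ e₂
        pure (Function.update S.1 j Rj, rj))
    (R, r)
  pure out.1

/-- Solve `Rᵀ y = g` for an upper triangular `R`. -/
def solveTranspose {n : ℕ} (R : Fin n → Fin n → ℝ) (g : Fin n → ℝ) : Counted (Fin n → ℝ) :=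
  (List.finRange n).foldlM
    (fun y j => do
      let s ← dot (fun k => R k j) y
      let e ← sub (g j) s
      let d ← div e (R j j)
      pure (Function.update y j d))
    (fun _ => 0)

/-- Solve `R z = y` for an upper triangular `R`. -/
def solveUpper {n : ℕ} (R : Fin n → Fin n → ℝ) (y : Fin n → ℝ) : Counted (Fin n → ℝ) :=
  (List.finRange n).reverse.foldlM
    (fun z j => do
      let s ← dot (R j) z
      let e ← sub (y j) s
      let d ← div e (R j j)
      pure (Function.update z j d))
    (fun _ => 0)

end Counted

/-! ## Conic programs and the interior point method -/

/-- A conic constraint on `x ∈ ℝⁿ`, given by its coefficients. -/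
inductive ConeBlock (n : ℕ) : Type
  /-- `‖A x + b‖₂ ≤ a₀ ⬝ x + b₀` with `A` of `q` rows: a second-order cone constraint of size
  `q + 1` (a linear inequality for `q = 0`). -/
  | soc (q : ℕ) (a₀ : Fin n → ℝ) (b₀ : ℝ) (A : Fin q → Fin n → ℝ) (b : Fin q → ℝ) : ConeBlock n
  /-- `F₀ + ∑ a, x a • F a ⪰ 0` with `p × p` matrices: a semidefinite constraint of size `p`. -/
  | psd (p : ℕ) (F₀ : Fin p → Fin p → ℝ) (F : Fin n → Fin p → Fin p → ℝ) : ConeBlock n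

/-- Minimize `(1/2) xᵀ quad x + lin ⬝ x` subject to the conic constraints `blocks`. -/
structure ConicData (n : ℕ) where
  quad : Matrix (Fin n) (Fin n) ℝ
  lin : Fin n → ℝ
  blocks : List (ConeBlock n)

open Counted in
/-- Second-order data at `x` of the logarithmic barrier of a constraint: rows `r` such that the
Hessian is the sum of all `rᵀ r`, and the gradient.

For a second-order cone constraint with slack `(s₀, s)` the barrier is `-log u`,
`u = s₀² - ‖s‖²`; with `J = diag (1, -1, …, -1)`, `v = J (s₀, s) / √u` and
`w = (v + e₀) / √(2 (v₀ + 1))`, its gradient in the slack is `-(2 / √u) v` and its Hessian is the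
square of `√(2 / u) (2 w wᵀ - J)`.

For a semidefinite constraint `X ⪰ 0` the barrier is `-log det X`; with `X = L Lᵀ` and
`N a = L⁻¹ (F a) L⁻ᵀ` its gradient is `-tr (N a)` and its Hessian is `tr (N a (N b)ᵀ)`. -/
def ConeBlock.barrier {n : ℕ} (x : Fin n → ℝ) :
    ConeBlock n → Counted (List (Fin n → ℝ) × (Fin n → ℝ))
  | .soc _ a₀ b₀ A b => do
      let d₀ ← dot a₀ x
      let s₀ ← add d₀ b₀
      let s ← vec fun i => do
        let d ← dot (A i) x
        add d (b i)
      let sq₀ ← mul s₀ s₀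
      let sq ← dot s s
      let u ← sub sq₀ sq
      let su ← Counted.sqrt u
      let v₀ ← div s₀ su
      let v ← vec fun i => do
        let e ← sub 0 (s i)
        div e su
      let v₁ ← add v₀ 1
      let e ← mul 2 v₁
      let den ← Counted.sqrt e
      let w₀ ← div v₁ den
      let w ← vec fun i => div (v i) den
      let two ← div 2 u
      let α ← Counted.sqrt two
      let z ← vec fun a => do
        let e₀ ← mul w₀ (a₀ a)
        let e ← dot w fun i => A i a
        let e' ← add e₀ e
        mul 2 e'
      let row₀ ← vec fun a => do
        let e ← mul w₀ (z a)
        let e' ← sub e (a₀ a)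
        mul α e'
      let rows ← vec fun i => vec fun a => do
        let e ← mul (w i) (z a)
        let e' ← add e (A i a)
        mul α e'
      let β ← div (-2) su
      let grad ← vec fun a => do
        let e₀ ← mul v₀ (a₀ a)
        let e ← dot v fun i => A i a
        let e' ← add e₀ e
        mul β e'
      pure (row₀ :: List.ofFn rows, grad)
  | .psd _ F₀ F => do
      let X ← vec fun i => vec fun j => do
        let e ← dot x fun a => F a i j
        add e (F₀ i j)
      let L ← cholesky X
      let G ← invLower L
      let N ← vec fun a => do
        let Y ← matMul G (F a)
        matMul Y fun k j => G j k
      let grad ← vec fun a => do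
        let e ← Counted.sum fun i => pure (N a i i)
        sub 0 e
      pure ((List.finRange _).flatMap fun i => (List.finRange _).map fun j => fun a => N a i j,
        grad)

open Counted in
/-- One iteration of the path-following interior point method at `(x, t)`: a damped Newton step
for `t • objective + barrier`, followed by `t ← θ t`. The Newton matrix is kept as `Rᵀ R` with `R`
upper triangular; `R₀` is such a factor of the (constant) Hessian `quad` of the objective. -/
def ipmStep {n : ℕ} (P : ConicData n) (R₀ : Matrix (Fin n) (Fin n) ℝ) (θ : ℝ)
    (st : (Fin n → ℝ) × ℝ) : Counted ((Fin n → ℝ) × ℝ) := do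
  let x := st.1
  let t := st.2
  let rt ← Counted.sqrt t
  let Rt ← vec fun i => vec fun j => mul rt (R₀ i j)
  let y ← vec fun i => dot (R₀ i) x
  let gt ← vec fun a => do
    let e ← dot (fun i => R₀ i a) y
    let e' ← add e (P.lin a)
    mul t e'
  let Rg ← P.blocks.foldlM
    (fun (S : (Fin n → Fin n → ℝ) × (Fin n → ℝ)) B => do
      let bar ← B.barrier x
      let R ← bar.1.foldlM insertRow S.1
      let g ← vec fun a => add (S.2 a) (bar.2 a)
      pure (R, g))
    (Rt, gt)
  let y ← solveTranspose Rg.1 Rg.2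
  let dir ← solveUpper Rg.1 y
  let l2 ← dot y y
  let l ← Counted.sqrt l2
  let l1 ← add 1 l
  let step ← div 1 l1
  let x' ← vec fun a => do
    let e ← mul step (dir a)
    sub (x a) e
  let t' ← mul θ t
  pure (x', t')

/-- `L` iterations of the interior point method. -/
def ipmRun {n : ℕ} (P : ConicData n) (R₀ : Matrix (Fin n) (Fin n) ℝ) (θ : ℝ) :
    ℕ → (Fin n → ℝ) × ℝ → Counted ((Fin n → ℝ) × ℝ)
  | 0, st => pure st
  | L + 1, st => do
      let st' ← ipmStep P R₀ θ st
      ipmRun P R₀ θ L st'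

/-- A second-order cone constraint `‖body x‖₂ ≤ top x` with affine `top`, `body`. -/
structure SocConstraint (ι : Type) where
  rows : ℕ
  top : (ι → ℝ) → ℝ
  body : (ι → ℝ) → Fin rows → ℝ

/-- A semidefinite constraint `mat x ⪰ 0` with affine `mat`. -/
structure PsdConstraint (ι : Type) where
  size : ℕ
  mat : (ι → ℝ) → Matrix (Fin size) (Fin size) ℝ

/-- The linear inequality `0 ≤ f x`. -/
def linConstraint {ι : Type} (f : (ι → ℝ) → ℝ) : SocConstraint ι := ⟨0, f, fun _ i => i.elim0⟩

/-- The constraint `‖body x‖₂ ≤ top x` with the rows of `body` indexed by a finite type. -/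
def socConstraint {ι : Type} (σ : Type) [Fintype σ] (top : (ι → ℝ) → ℝ)
    (body : (ι → ℝ) → σ → ℝ) : SocConstraint ι :=
  ⟨Fintype.card σ, top, fun x i => body x ((Fintype.equivFin σ).symm i)⟩

/-- The constraint `mat x ⪰ 0` for matrices indexed by a finite type. -/
def psdConstraint {ι : Type} (σ : Type) [Fintype σ]
    (mat : (ι → ℝ) → Matrix σ σ ℝ) : PsdConstraint ι :=
  ⟨Fintype.card σ, fun x => (mat x).submatrix (Fintype.equivFin σ).symm (Fintype.equivFin σ).symm⟩

/-- Minimize the quadratic function `obj` subject to conic constraints; `ι` indexes the scalar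
decision variables. -/
structure ConicProblem (ι : Type) where
  obj : (ι → ℝ) → ℝ
  socs : List (SocConstraint ι)
  psds : List (PsdConstraint ι)

/-- The coefficients of a conic problem, with the decision variables numbered by
`Fin (Fintype.card ι)`: those of an affine `f` are `f 0` and `f e - f 0`, those of the quadratic
objective (up to its constant term) are found by polarization. -/
def ConicProblem.toData {ι : Type} [Fintype ι] (P : ConicProblem ι) :
    ConicData (Fintype.card ι) :=
  let e : Fin (Fintype.card ι) → ι → ℝ := fun a i => if Fintype.equivFin ι i = a then 1 else 0
  let Q : Matrix (Fin (Fintype.card ι)) (Fin (Fintype.card ι)) ℝ :=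
    fun a b => P.obj (e a + e b) - P.obj (e a) - P.obj (e b) + P.obj 0
  { quad := Q
    lin := fun a => P.obj (e a) - P.obj 0 - Q a a / 2
    blocks :=
      P.socs.map (fun c => ConeBlock.soc c.rows (fun a => c.top (e a) - c.top 0) (c.top 0)
        (fun i a => c.body (e a) i - c.body 0 i) (c.body 0)) ++
      P.psds.map (fun c => ConeBlock.psd c.size (c.mat 0)
        (fun a => c.mat (e a) - c.mat 0)) }

/-- The number of arithmetic operations of `L` iterations of the interior point method on `P`. -/
def ConicProblem.ipmOps {ι : Type} [Fintype ι] (P : ConicProblem ι)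
    (R₀ : Matrix (Fin (Fintype.card ι)) (Fin (Fintype.card ι)) ℝ) (θ : ℝ)
    (x₀ : Fin (Fintype.card ι) → ℝ) (t₀ : ℝ) (L : ℕ) : ℕ :=
  (ipmRun P.toData R₀ θ L (x₀, t₀)).ops

/-- `R₀` is an upper triangular factor of the Hessian of the objective of `P`. -/
def ConicProblem.IsFactor {ι : Type} [Fintype ι] (P : ConicProblem ι)
    (R₀ : Matrix (Fin (Fintype.card ι)) (Fin (Fintype.card ι)) ℝ) : Prop :=
  R₀.BlockTriangular id ∧ R₀ᵀ * R₀ = P.toData.quad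

/-! ## Agents -/

/-- Index of the components of `ζ = [d̄₀; d₀; …; d_{T-1}]`. -/
abbrev ZetaIdx (T nx nd : ℕ) : Type := Fin nx ⊕ Fin T × Fin nd

/-- Index of the control parameters of an agent: the components of the feed-forward controls
`ū_k`, and the entries of the gains `K_{k,l}` with `k - γ + 1 ≤ l ≤ k`. -/
abbrev CtrlIdx (T nx nu γ : ℕ) : Type :=
  (Fin T × Fin nu) ⊕
    ({p : Fin T × Fin T // p.2 ≤ p.1 ∧ (p.1 : ℕ) < p.2 + γ} × Fin nu × Fin nx)

/-- An agent: dynamics `x_{k+1} = A_k x_k + B_k u_k + C_k d_k`, known part of the initial state, and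
uncertainty set `{ζ | ζᵀ S ζ ≤ τ}`. The factor `W` serves to write `‖v‖_{S⁻¹}` as `‖W v‖₂`. -/
structure Agent (T nx nu nd : ℕ) where
  A : ℕ → Matrix (Fin nx) (Fin nx) ℝ
  B : ℕ → Matrix (Fin nx) (Fin nu) ℝ
  C : ℕ → Matrix (Fin nx) (Fin nd) ℝ
  x₀ : Fin nx → ℝ
  S : Matrix (ZetaIdx T nx nd) (ZetaIdx T nx nd) ℝ
  S_posDef : S.PosDef
  W : Matrix (ZetaIdx T nx nd) (ZetaIdx T nx nd) ℝ
  W_factor : Wᵀ * W = S⁻¹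
  τ : ℝ
  τ_pos : 0 < τ

namespace Agent

variable {T nx nu nd : ℕ}

/-- The transition matrix `Φ(k, l) = A_{k-1} ⋯ A_l`, the identity for `k ≤ l`. -/
def Φ (a : Agent T nx nu nd) : ℕ → ℕ → Matrix (Fin nx) (Fin nx) ℝ
  | 0, _ => 1
  | k + 1, l => if l ≤ k then a.A k * a.Φ k l else 1

/-- The block column with blocks `Φ(k, 0)`. -/
def G₀ (a : Agent T nx nu nd) : Matrix (Fin (T + 1) × Fin nx) (Fin nx) ℝ :=
  fun r j => a.Φ r.1 0 r.2 j

/-- The block matrix with blocks `Φ(k, l + 1) B_l` for `l < k`. -/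
def Gu (a : Agent T nx nu nd) : Matrix (Fin (T + 1) × Fin nx) (Fin T × Fin nu) ℝ :=
  fun r c => if (c.1 : ℕ) < r.1 then (a.Φ r.1 (c.1 + 1) * a.B c.1) r.2 c.2 else 0

/-- The block matrix with first block column `Φ(k, 0)` and then the blocks `Φ(k, l + 1) C_l` for
`l < k`. -/
def Gζ (a : Agent T nx nu nd) : Matrix (Fin (T + 1) × Fin nx) (ZetaIdx T nx nd) ℝ :=
  fun r c => match c with
    | .inl j => a.Φ r.1 0 r.2 j
    | .inr c => if (c.1 : ℕ) < r.1 then (a.Φ r.1 (c.1 + 1) * a.C c.1) r.2 c.2 else 0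

end Agent

/-- The feed-forward control sequence contained in the control parameters. -/
def feedforward {T nx nu γ : ℕ} (p : CtrlIdx T nx nu γ → ℝ) : Fin T × Fin nu → ℝ :=
  fun r => p (.inl r)

/-- The block lower triangular feedback matrix contained in the control parameters. -/
def feedback {T nx nu γ : ℕ} (p : CtrlIdx T nx nu γ → ℝ) :
    Matrix (Fin T × Fin nu) (Fin (T + 1) × Fin nx) ℝ :=
  fun r c =>
    if h : (c.1 : ℕ) ≤ r.1 ∧ (r.1 : ℕ) < c.1 + γ then
      p (.inr (⟨(r.1, ⟨c.1, lt_of_le_of_lt h.1 r.1.isLt⟩), Fin.le_def.2 h.1, h.2⟩, r.2, c.2))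
    else 0

namespace Agent

variable {T nx nu nd γ : ℕ}

/-- The disturbance-free mean `G₀ x̄₀ + Gu ū`. -/
def mean (a : Agent T nx nu nd) (p : CtrlIdx T nx nu γ → ℝ) : Fin (T + 1) × Fin nx → ℝ :=
  a.G₀ *ᵥ a.x₀ + a.Gu *ᵥ feedforward p

/-- The matrix `M = (Gu K + I) Gζ`, so that the mean trajectory is `mean + M ζ`. -/
def gain (a : Agent T nx nu nd) (p : CtrlIdx T nx nu γ → ℝ) :
    Matrix (Fin (T + 1) × Fin nx) (ZetaIdx T nx nd) ℝ :=
  (a.Gu * feedback p + 1) * a.Gζ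

/-- The disturbance-free mean position `H μ_{k+1}` after step `k`. -/
def posMean {m : ℕ} (a : Agent T nx nu nd) (H : Matrix (Fin m) (Fin nx) ℝ)
    (p : CtrlIdx T nx nu γ → ℝ) (k : Fin T) : Fin m → ℝ :=
  H *ᵥ fun i => a.mean p (k.succ, i)

/-- The matrix `H P_{k+1} M`: the effect of `ζ` on the mean position after step `k`. -/
def posGain {m : ℕ} (a : Agent T nx nu nd) (H : Matrix (Fin m) (Fin nx) ℝ)
    (p : CtrlIdx T nx nu γ → ℝ) (k : Fin T) : Matrix (Fin m) (ZetaIdx T nx nd) ℝ :=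
  H * (a.gain p).submatrix (fun i => (k.succ, i)) id

end Agent

/-- What the local subproblem of an agent is built from: the agent (`none`) and its `ni` neighbors
(`some j`), the position matrix `H`, the `no` obstacles with their clearances, the clearances
between agents, and the weights of the control effort. -/
structure LocalData (T m nx nu nd ni no : ℕ) where
  agent : Option (Fin ni) → Agent T nx nu nd
  H : Matrix (Fin m) (Fin nx) ℝ
  center : Fin no → Fin m → ℝ
  obsDist : Fin no → ℝ
  interDist : Fin ni → ℝ
  Ru : Matrix (Fin T × Fin nu) (Fin T × Fin nu) ℝ
  Ru_posSemidef : Ru.PosSemidef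
  RK : Matrix (Fin T × Fin nu) (Fin T × Fin nu) ℝ

/-- The control effort `ūᵀ Ru ū + ‖RK K‖_F²`. -/
def LocalData.effort {T m nx nu nd ni no γ : ℕ} (D : LocalData T m nx nu nd ni no)
    (p : CtrlIdx T nx nu γ → ℝ) : ℝ :=
  feedforward p ⬝ᵥ (D.Ru *ᵥ feedforward p) + ∑ r, ∑ c, (D.RK * feedback p) r c ^ 2

/-- The consensus terms `λᵀ (y - ν) + (ρ / 2) ‖y - ν‖²` of the augmented Lagrangian. -/
def consensus {σ : Type} [Fintype σ] (lam ν : σ → ℝ) (ρ : ℝ) (y : σ → ℝ) : ℝ :=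
  ∑ s, (lam s * (y s - ν s) + ρ / 2 * (y s - ν s) ^ 2)

/-! ## The local subproblem in the SDP framework -/

/-- The S-lemma matrix of the constraint `‖d + G ζ‖₂² ≥ c²` for all `ζᵀ S ζ ≤ τ`, after
linearizing the left-hand side in `(d, G)` at `(dl, Gl)`; `β` is the multiplier. -/
def robustLMI {m : ℕ} {Z : Type} [Fintype Z] (d dl : Fin m → ℝ) (G Gl : Matrix (Fin m) Z ℝ)
    (S : Matrix Z Z ℝ) (τ c β : ℝ) : Matrix (Z ⊕ Unit) (Z ⊕ Unit) ℝ :=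
  let q : Z → ℝ := dl ᵥ* G + (d - dl) ᵥ* Gl
  Matrix.fromBlocks (Glᵀ * G + (G - Gl)ᵀ * Gl + β • S) (fun i _ => q i) (fun _ j => q j)
    (fun _ _ => dl ⬝ᵥ (2 • d - dl) - c ^ 2 - β * τ)

/-- Decision variables: the control parameters of the agent (`none`) and the local copies of those
of its neighbors, and one multiplier per time step and obstacle or neighbor. -/
abbrev SdpVar (T nx nu γ ni no : ℕ) : Type :=
  (Option (Fin ni) × CtrlIdx T nx nu γ) ⊕ (Fin T × (Fin no ⊕ Fin ni))

/-- The current iterates of ADMM: nominal values for the linearization, dual and global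
variables, and penalty parameter. -/
structure SdpRound (T nx nu γ ni : ℕ) where
  nominal : Option (Fin ni) → CtrlIdx T nx nu γ → ℝ
  lam : Option (Fin ni) × CtrlIdx T nx nu γ → ℝ
  ν : Option (Fin ni) × CtrlIdx T nx nu γ → ℝ
  ρ : ℝ
  ρ_pos : 0 < ρ

/-- The local subproblem with S-lemma constraints: per time step, one of size `n_ζ + 1` for each
obstacle and one of size `2 n_ζ + 1` for each neighbor (where the two ellipsoids enter through the
aggregated bound `ζᵢᵀ Sᵢ ζᵢ + ζⱼᵀ Sⱼ ζⱼ ≤ τᵢ + τⱼ` with a single multiplier). -/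
def sdpSubproblem {T m nx nu nd γ ni no : ℕ} (D : LocalData T m nx nu nd ni no)
    (s : SdpRound T nx nu γ ni) : ConicProblem (SdpVar T nx nu γ ni no) :=
  let ctrl : (SdpVar T nx nu γ ni no → ℝ) → Option (Fin ni) → CtrlIdx T nx nu γ → ℝ :=
    fun x j c => x (.inl (j, c))
  let pos := fun (j : Option (Fin ni)) (p : CtrlIdx T nx nu γ → ℝ) (k : Fin T) =>
    (D.agent j).posMean D.H p k
  let pg := fun (j : Option (Fin ni)) (p : CtrlIdx T nx nu γ → ℝ) (k : Fin T) =>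
    (D.agent j).posGain D.H p k
  { obj := fun x =>
      D.effort (ctrl x none) + consensus s.lam s.ν s.ρ (fun c => x (.inl c))
    socs := (Finset.univ : Finset (Fin T × (Fin no ⊕ Fin ni))).toList.map fun b =>
      linConstraint fun x => x (.inr b)
    psds :=
      ((Finset.univ : Finset (Fin T × Fin no)).toList.map fun b =>
        psdConstraint (ZetaIdx T nx nd ⊕ Unit) fun x =>
          robustLMI
            (pos none (ctrl x none) b.1 - D.center b.2)
            (pos none (s.nominal none) b.1 - D.center b.2)
            (pg none (ctrl x none) b.1) (pg none (s.nominal none) b.1)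
            (D.agent none).S (D.agent none).τ (D.obsDist b.2) (x (.inr (b.1, .inl b.2)))) ++
      ((Finset.univ : Finset (Fin T × Fin ni)).toList.map fun b =>
        psdConstraint ((ZetaIdx T nx nd ⊕ ZetaIdx T nx nd) ⊕ Unit) fun x =>
          robustLMI
            (pos none (ctrl x none) b.1 - pos (some b.2) (ctrl x (some b.2)) b.1)
            (pos none (s.nominal none) b.1 - pos (some b.2) (s.nominal (some b.2)) b.1)
            (Matrix.fromCols (pg none (ctrl x none) b.1)
              (-pg (some b.2) (ctrl x (some b.2)) b.1))
            (Matrix.fromCols (pg none (s.nominal none) b.1)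
              (-pg (some b.2) (s.nominal (some b.2)) b.1))
            (Matrix.fromBlocks (D.agent none).S 0 0 (D.agent (some b.2)).S)
            ((D.agent none).τ + (D.agent (some b.2)).τ) (D.interDist b.2)
            (x (.inr (b.1, .inr b.2)))) }

/-! ## The local subproblem in the proposed framework -/

/-- Decision variables: the control parameters of the agent; the bounds `μ_d` of the agent (`none`)
and the local copies of those of its neighbors; the local copies of the disturbance-free mean
positions of its neighbors; one slack variable per time step and obstacle or neighbor. -/
abbrev SocpVar (T m nx nu γ ni no : ℕ) : Type :=
  CtrlIdx T nx nu γ ⊕ (Option (Fin ni) × Fin T × Fin m) ⊕ (Fin ni × Fin T × Fin m) ⊕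
    (Fin T × (Fin no ⊕ Fin ni))

/-- The current iterates of ADMM: nominal positions for the linearization, dual and global
variables, and penalty parameters. -/
structure SocpRound (T m ni : ℕ) where
  nominal : Option (Fin ni) → Fin T → Fin m → ℝ
  lamU : Option (Fin ni) × Fin T × Fin m → ℝ
  lamD : Option (Fin ni) × Fin T × Fin m → ℝ
  νU : Option (Fin ni) × Fin T × Fin m → ℝ
  νD : Option (Fin ni) × Fin T × Fin m → ℝ
  ρU : ℝ
  ρU_pos : 0 < ρU
  ρD : ℝ
  ρD_pos : 0 < ρD

/-- The linearization `dlᵀ d / ‖dl‖₂` of `‖d‖₂` at `dl`. -/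
def normLinearized {m : ℕ} (dl d : Fin m → ℝ) : ℝ := dl ⬝ᵥ d / Real.sqrt (dl ⬝ᵥ dl)

/-- The local subproblem with the proposed constraints. With slack `c̃` and clearance `c`, at each
time step: the linearized `‖position - center‖ ≥ c̃` and `‖μ_d‖ ≤ c̃ - c` for each obstacle, the
linearized `‖position - positionⱼ‖ ≥ c̃` and `‖μ_d + μ_dⱼ‖ ≤ c̃ - c` for each neighbor, and
`√τ ‖Mᵀ h‖_{S⁻¹} ≤ (μ_d)ᵢ` for each row `hᵀ` of the position matrix at that time. -/
def socpSubproblem {T m nx nu nd γ ni no : ℕ} (D : LocalData T m nx nu nd ni no)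
    (s : SocpRound T m ni) : ConicProblem (SocpVar T m nx nu γ ni no) :=
  let a := D.agent none
  let ctrl : (SocpVar T m nx nu γ ni no → ℝ) → CtrlIdx T nx nu γ → ℝ := fun x c => x (.inl c)
  let μd : (SocpVar T m nx nu γ ni no → ℝ) → Option (Fin ni) → Fin T → Fin m → ℝ :=
    fun x j k i => x (.inr (.inl (j, k, i)))
  let pos : (SocpVar T m nx nu γ ni no → ℝ) → Option (Fin ni) → Fin T → Fin m → ℝ :=
    fun x j k i => match j with
      | none => a.posMean D.H (ctrl x) k i
      | some j => x (.inr (.inr (.inl (j, k, i))))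
  let slack : (SocpVar T m nx nu γ ni no → ℝ) → Fin T → Fin no ⊕ Fin ni → ℝ :=
    fun x k b => x (.inr (.inr (.inr (k, b))))
  { obj := fun x =>
      D.effort (ctrl x) + consensus s.lamU s.νU s.ρU (fun c => pos x c.1 c.2.1 c.2.2) +
        consensus s.lamD s.νD s.ρD (fun c => μd x c.1 c.2.1 c.2.2)
    socs :=
      ((Finset.univ : Finset (Fin T × Fin no)).toList.map fun b =>
        linConstraint fun x =>
          normLinearized (s.nominal none b.1 - D.center b.2) (pos x none b.1 - D.center b.2) -
            slack x b.1 (.inl b.2)) ++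
      ((Finset.univ : Finset (Fin T × Fin ni)).toList.map fun b =>
        linConstraint fun x =>
          normLinearized (s.nominal none b.1 - s.nominal (some b.2) b.1)
              (pos x none b.1 - pos x (some b.2) b.1) -
            slack x b.1 (.inr b.2)) ++
      ((Finset.univ : Finset (Fin T × Fin no)).toList.map fun b =>
        socConstraint (Fin m) (fun x => slack x b.1 (.inl b.2) - D.obsDist b.2)
          (fun x => μd x none b.1)) ++
      ((Finset.univ : Finset (Fin T × Fin ni)).toList.map fun b =>
        socConstraint (Fin m) (fun x => slack x b.1 (.inr b.2) - D.interDist b.2)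
          (fun x => μd x none b.1 + μd x (some b.2) b.1)) ++
      ((Finset.univ : Finset (Fin T × Fin m)).toList.map fun b =>
        socConstraint (ZetaIdx T nx nd) (fun x => μd x none b.1 b.2)
          (fun x => Real.sqrt a.τ • (a.W *ᵥ fun z => a.posGain D.H (ctrl x) b.1 b.2 z)))
    psds := [] }

end

/-! The proof multiplies three counts: constraints, decision variables `n`, and cone sizes. Control
flow depends on computed values only through a zero test in `insertRow`, so every routine has a cost
bound in its dimensions alone, valid for arbitrary inputs; no invariant of the iterates is needed.

Inserting one row into the triangular factor costs `O(n²)`. A second-order cone with `q` body rows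
contributes `q + 1` rows, hence `O(n² (q + 1))`. A semidefinite block of size `p` contributes `p²`
rows, and forming its `n` matrices `L⁻¹ (F a) L⁻ᵀ` costs `O(n p³)`; together `O(n² p² + n p³)` up to
lower-order terms. The rest of a Newton step is `O(n²)` (`ConicData.ops_ipmStep_le`).

Write `N = ni + no` and `g = nu nx γ`. In both frameworks `n = O(T N g)`, and `nx ≤ κ T nd` makes
the dimension of `ζ` `O(T nd)`. The SDP framework has `O(T N)` blocks with `p = O(T nd)`; the extra
hypothesis on `nd` gives `p = O(n)`, so `n² p²` dominates and the total is of order `T N (T N g)² (T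
nd)²`. In the proposed framework the large cones have only `O(T nd)` rows and the others at most `m
+ 1`, so one factor `T nd` disappears. -/

namespace Counted

variable {α β : Type}

/-! ### Operation counts of the linear algebra routines. -/

@[simp] lemma ops_pure (a : α) : (pure a : Counted α).ops = 0 := rfl

@[simp] lemma val_pure (a : α) : (pure a : Counted α).val = a := rfl

@[simp] lemma ops_bind (x : Counted α) (f : α → Counted β) :
    (x >>= f).ops = x.ops + (f x.val).ops := rfl

@[simp] lemma val_bind (x : Counted α) (f : α → Counted β) :
    (x >>= f).val = (f x.val).val := rfl

@[simp] lemma ops_add (a b : ℝ) : (add a b).ops = 1 := rfl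
@[simp] lemma ops_sub (a b : ℝ) : (sub a b).ops = 1 := rfl
@[simp] lemma ops_mul (a b : ℝ) : (mul a b).ops = 1 := rfl
@[simp] lemma ops_div (a b : ℝ) : (div a b).ops = 1 := rfl
@[simp] lemma ops_sqrt (a : ℝ) : (Counted.sqrt a).ops = 1 := rfl
@[simp] lemma ops_isZero (a : ℝ) : (isZero a).ops = 1 := rfl

@[simp] lemma ops_vec {n : ℕ} (f : Fin n → Counted α) : (vec f).ops = ∑ i, (f i).ops := rfl

@[simp] lemma ops_sum {n : ℕ} (f : Fin n → Counted ℝ) :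
    (Counted.sum f).ops = ∑ i, ((f i).ops + 1) := rfl

@[simp] lemma ops_dot {n : ℕ} (u v : Fin n → ℝ) : (dot u v).ops = n * 2 := by simp [dot]

@[simp] lemma ops_matMul {p q r : ℕ} (A : Fin p → Fin q → ℝ) (B : Fin q → Fin r → ℝ) :
    (matMul A B).ops = p * (r * (q * 2)) := by simp [matMul]

lemma ops_vec_le {n c : ℕ} {f : Fin n → Counted α} (h : ∀ i, (f i).ops ≤ c) :
    (vec f).ops ≤ n * c := by
  simpa using Finset.sum_le_card_nsmul Finset.univ _ c fun i _ => h i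

/-- The bound `c a` is uniform in the accumulator, so the loop state never has to be tracked. All
loops below are estimated through this lemma. -/
lemma ops_foldlM_le {f : β → α → Counted β} {c : α → ℕ} (h : ∀ b a, (f b a).ops ≤ c a)
    (l : List α) (b : β) : (l.foldlM f b).ops ≤ (l.map c).sum := by
  induction l generalizing b with
  | nil => simp
  | cons a l ih =>
    simp only [List.foldlM_cons, ops_bind, List.map_cons, List.sum_cons]
    exact add_le_add (h b a) (ih _)

lemma ops_foldlM_le_length_mul {f : β → α → Counted β} {c : ℕ} (h : ∀ b a, (f b a).ops ≤ c)
    (l : List α) (b : β) : (l.foldlM f b).ops ≤ l.length * c := by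
  simpa using ops_foldlM_le (c := fun _ => c) h l b

lemma ops_cholesky_le {p : ℕ} (X : Fin p → Fin p → ℝ) :
    (cholesky X).ops ≤ p * (2 * p + 2 + p * (2 * p + 2)) := by
  refine (ops_foldlM_le_length_mul (c := 2 * p + 2 + p * (2 * p + 2)) (fun L j => ?_) _ _).trans
    (by simp)
  have h : ∀ (d : ℝ), (vec fun i => if i < j then pure 0 else if i = j then pure d else do
      let s' ← dot (L i) (L j)
      let e' ← sub (X i j) s'
      div e' d).ops ≤ p * (2 * p + 2) := fun d => ops_vec_le fun i => by
    split_ifs <;> simp; omega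
  simp only [ops_bind, ops_dot, ops_sub, ops_sqrt, ops_pure]
  have := h (Counted.sqrt (sub (X j j) (dot (L j) (L j)).val).val).val
  omega

lemma ops_invLower_le {p : ℕ} (L : Fin p → Fin p → ℝ) :
    (invLower L).ops ≤ p * (p * (2 * p + 2)) := by
  refine (ops_foldlM_le_length_mul (c := p * (2 * p + 2)) (fun G i => ?_) _ _).trans (by simp)
  simp only [ops_bind, ops_pure, add_zero]
  refine ops_vec_le fun c => ?_
  simp
  omega

lemma ops_insertRow_le {n : ℕ} (R : Fin n → Fin n → ℝ) (r : Fin n → ℝ) :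
    (insertRow R r).ops ≤ n * (6 * n + 7) := by
  rw [insertRow, ops_bind, ops_pure, add_zero]
  -- One rotation: five operations up to the zero test, two divisions, and three operations for each
  -- of the `2 n` updated entries. The branch `h = 0` is cheaper.
  refine (ops_foldlM_le_length_mul (c := 6 * n + 7) (fun S j => ?_) _ _).trans (by simp)
  simp only [ops_bind, ops_mul, ops_add, ops_sqrt, ops_isZero]
  split_ifs
  · simp
  · simp
    omega

lemma ops_solveTranspose_le {n : ℕ} (R : Fin n → Fin n → ℝ) (g : Fin n → ℝ) :
    (solveTranspose R g).ops ≤ n * (2 * n + 2) := by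
  refine (ops_foldlM_le_length_mul (c := 2 * n + 2) (fun y j => ?_) _ _).trans (by simp)
  simp
  omega

lemma ops_solveUpper_le {n : ℕ} (R : Fin n → Fin n → ℝ) (y : Fin n → ℝ) :
    (solveUpper R y).ops ≤ n * (2 * n + 2) := by
  refine (ops_foldlM_le_length_mul (c := 2 * n + 2) (fun y j => ?_) _ _).trans (by simp)
  simp
  omega

end Counted

/-! ### Cost of a constraint and of a Newton step. -/

/-- The number of rows by which a constraint updates the triangular factor. -/
def ConeBlock.rowCount {n : ℕ} : ConeBlock n → ℕ
  | .soc q _ _ _ _ => q + 1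
  | .psd p _ _ => p * p

/-- A bound for the operations spent on the barrier of a constraint. -/
def ConeBlock.barrierBound {n : ℕ} : ConeBlock n → ℕ
  | .soc q _ _ _ _ => 20 + 10 * q + 20 * n * (q + 1)
  | .psd p _ _ => p * (p * (2 * n + 1)) + p * (2 * p + 2 + p * (2 * p + 2)) +
      p * (p * (2 * p + 2)) + n * (4 * p * p * p) + n * (p + 1)

/-- A bound for the operations that a constraint causes in a Newton step in `n` variables. -/
def ConeBlock.cost {n : ℕ} : ConeBlock n → ℕ
  | .soc q _ _ _ _ => 80 * (n ^ 2 * (q + 1))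
  | .psd p _ _ => 80 * (n ^ 2 * (p + 1) ^ 2 + n * (p + 1) ^ 3)

lemma ConeBlock.length_barrier {n : ℕ} (x : Fin n → ℝ) (B : ConeBlock n) :
    (B.barrier x).val.1.length = B.rowCount := by
  cases B <;> simp [ConeBlock.barrier, ConeBlock.rowCount]

lemma ConeBlock.ops_barrier_le {n : ℕ} (x : Fin n → ℝ) (B : ConeBlock n) :
    (B.barrier x).ops ≤ B.barrierBound := by
  cases B with
  | soc q a₀ b₀ A b =>
    simp [ConeBlock.barrier, ConeBlock.barrierBound]
    nlinarith [Nat.zero_le (n * q), Nat.zero_le n, Nat.zero_le q]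
  | psd p F₀ F =>
    simp only [ConeBlock.barrier, ConeBlock.barrierBound, Counted.ops_bind, Counted.ops_pure,
      Counted.ops_vec, Counted.ops_matMul, Counted.ops_sum, Counted.ops_sub, Counted.ops_dot,
      Counted.ops_add, Finset.sum_const, Finset.card_univ, Fintype.card_fin, smul_eq_mul]
    generalize hX : Counted.val (Counted.vec (n := p) (α := Fin p → ℝ) _) = X
    have h₁ := Counted.ops_cholesky_le X
    have h₂ := Counted.ops_invLower_le (Counted.cholesky X).val
    nlinarith

/-- Adds up all the work one block causes: its barrier data, one `insertRow` per row, and `n`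
additions for the gradient. Lower-order terms are absorbed thanks to `n ≥ 1` and to `p + 1` in place
of `p` in `cost`. -/
lemma ConeBlock.barrierBound_add_le_cost {n : ℕ} (hn : 1 ≤ n) (B : ConeBlock n) :
    B.barrierBound + B.rowCount * (n * (6 * n + 7)) + n ≤ B.cost := by
  -- After the shift `n ↦ n + 1` the claim compares polynomials with natural coefficients, monomial
  -- by monomial.
  obtain ⟨n, rfl⟩ := Nat.exists_eq_add_of_le' hn
  cases B with
  | soc q a₀ b₀ A b =>
    simp only [barrierBound, rowCount, cost]
    ring_nf
    nlinarith [Nat.zero_le (n * q), Nat.zero_le (n ^ 2 * q), Nat.zero_le (n ^ 2)]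
  | psd p F₀ F =>
    simp only [barrierBound, rowCount, cost]
    ring_nf
    omega

lemma ConicData.ops_ipmStep_le {n : ℕ} (hn : 1 ≤ n) (P : ConicData n)
    (R₀ : Matrix (Fin n) (Fin n) ℝ) (θ : ℝ) (st : (Fin n → ℝ) × ℝ) :
    (ipmStep P R₀ θ st).ops ≤ 40 * n ^ 2 + (P.blocks.map ConeBlock.cost).sum := by
  have hfold : ∀ S : (Fin n → Fin n → ℝ) × (Fin n → ℝ),
      (P.blocks.foldlM (fun (S : (Fin n → Fin n → ℝ) × (Fin n → ℝ)) (B : ConeBlock n) =>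
        B.barrier st.1 >>= fun bar => bar.1.foldlM Counted.insertRow S.1 >>= fun R =>
          Counted.vec (fun a => Counted.add (S.2 a) (bar.2 a)) >>= fun g =>
            (pure (R, g) : Counted ((Fin n → Fin n → ℝ) × (Fin n → ℝ)))) S).ops ≤
        (P.blocks.map ConeBlock.cost).sum := by
    refine Counted.ops_foldlM_le (fun S B => ?_) _
    refine le_trans ?_ (B.barrierBound_add_le_cost hn)
    have h₁ := B.ops_barrier_le st.1
    have h₂ := Counted.ops_foldlM_le_length_mul (fun R r => Counted.ops_insertRow_le R r)
      (B.barrier st.1).val.1 S.1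
    rw [B.length_barrier] at h₂
    simp
    omega
  simp only [ipmStep, Counted.ops_bind, Counted.ops_pure,
      Counted.ops_vec, Counted.ops_sub, Counted.ops_dot, Counted.ops_sqrt, Counted.ops_div,
      Counted.ops_mul,
      Counted.ops_add, Finset.sum_const, Finset.card_univ, Fintype.card_fin, smul_eq_mul]
  -- The computed values are irrelevant to the count, so they are made opaque; this is why `hfold`
  -- is stated for every starting state.
  generalize Counted.val (Counted.vec (n := n) (α := Fin n → ℝ) _) = Rt
  generalize Counted.val (Counted.vec (n := n) (α := ℝ) fun a => _) = gt
  have h := hfold (Rt, gt)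
  generalize List.foldlM (m := Counted) _ _ P.blocks = F at h ⊢
  have h₁ := Counted.ops_solveTranspose_le F.val.1 F.val.2
  have h₂ := Counted.ops_solveUpper_le F.val.1 (Counted.solveTranspose F.val.1 F.val.2).val
  nlinarith

lemma ConicData.ops_ipmRun_le {n : ℕ} (hn : 1 ≤ n) (P : ConicData n)
    (R₀ : Matrix (Fin n) (Fin n) ℝ) (θ : ℝ) (L : ℕ) (st : (Fin n → ℝ) × ℝ) :
    (ipmRun P R₀ θ L st).ops ≤ L * (40 * n ^ 2 + (P.blocks.map ConeBlock.cost).sum) := by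
  induction L generalizing st with
  | zero => simp [ipmRun]
  | succ L ih =>
    rw [ipmRun, Counted.ops_bind, add_mul, one_mul, add_comm]
    exact add_le_add (ih _) (P.ops_ipmStep_le hn R₀ θ st)

/-! ### Number of decision variables. -/

lemma card_ctrlIdx_le {T nx nu γ : ℕ} (hx : 1 ≤ nx) (hγ : 1 ≤ γ) :
    Fintype.card (CtrlIdx T nx nu γ) ≤ 2 * (T * (nu * nx * γ)) := by
  have h : Fintype.card {p : Fin T × Fin T // p.2 ≤ p.1 ∧ (p.1 : ℕ) < p.2 + γ} ≤ T * γ := by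
    -- A pair `(k, l)` in the band is determined by `k` and the lag `k - l < γ`, so there are at
    -- most `T γ` gain blocks instead of `T²`.
    let f : {p : Fin T × Fin T // p.2 ≤ p.1 ∧ (p.1 : ℕ) < p.2 + γ} → Fin T × Fin γ :=
      fun p => (p.1.1, ⟨p.1.1 - p.1.2, by have := p.2.1; have := p.2.2; omega⟩)
    have hf : Function.Injective f := by
      rintro ⟨⟨a, b⟩, h₁, h₂⟩ ⟨⟨c, d⟩, h₃, h₄⟩ h
      simp only [f, Prod.mk.injEq, Fin.mk.injEq] at h
      simp only [Fin.le_def] at h₁ h₃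
      obtain ⟨rfl, h⟩ := h
      simp only [Subtype.mk.injEq, Prod.mk.injEq, true_and]
      ext
      omega
    simpa using Fintype.card_le_of_injective f hf
  simp only [Fintype.card_sum, Fintype.card_prod, Fintype.card_fin]
  have h₁ : T * nu ≤ T * (nu * nx * γ) := by
    rw [mul_assoc nu]
    exact Nat.mul_le_mul_left _ (Nat.le_mul_of_pos_right _ (Nat.mul_pos hx hγ))
  have h₂ := Nat.mul_le_mul_right (nu * nx) h
  nlinarith

lemma card_sdpVar_le {T nx nu γ ni no : ℕ} (hx : 1 ≤ nx) (hu : 1 ≤ nu) (hγ : 1 ≤ γ)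
    (hN : 1 ≤ ni + no) :
    Fintype.card (SdpVar T nx nu γ ni no) ≤ 5 * (T * (ni + no) * (nu * nx * γ)) := by
  have h := card_ctrlIdx_le (T := T) (nu := nu) hx hγ
  have hg : 0 < nu * nx * γ := Nat.mul_pos (Nat.mul_pos hu hx) hγ
  rw [Fintype.card_sum, Fintype.card_prod, Fintype.card_option, Fintype.card_fin]
  generalize Fintype.card (CtrlIdx T nx nu γ) = c at h ⊢
  simp only [Fintype.card_prod, Fintype.card_sum, Fintype.card_fin]
  have h₁ : (ni + 1) * c ≤ (2 * (ni + no)) * (2 * (T * (nu * nx * γ))) :=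
    Nat.mul_le_mul (by omega) h
  have h₂ : T * (no + ni) ≤ T * (ni + no) * (nu * nx * γ) := by
    rw [add_comm no]
    exact Nat.le_mul_of_pos_right _ hg
  linarith

/-- Only the agent's own controls occur, and neighbors enter through `m`-vectors. The factors `N`
and `g` are multiplied together merely to reach the same form as in the SDP framework; `3 m + 3` is
`2` (controls) `+ 2 m` (bounds) `+ m` (mean positions) `+ 1` (slacks). -/
lemma card_socpVar_le {T m nx nu γ ni no : ℕ} (hx : 1 ≤ nx) (hu : 1 ≤ nu) (hγ : 1 ≤ γ)
    (hN : 1 ≤ ni + no) :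
    Fintype.card (SocpVar T m nx nu γ ni no) ≤
      (3 * m + 3) * (T * (ni + no) * (nu * nx * γ)) := by
  have h := card_ctrlIdx_le (T := T) (nu := nu) hx hγ
  rw [Fintype.card_sum]
  simp only [Fintype.card_prod, Fintype.card_sum, Fintype.card_fin, Fintype.card_option] at h ⊢
  have hg : 1 ≤ nu * nx * γ := Nat.mul_pos (Nat.mul_pos hu hx) hγ
  generalize nu * nx * γ = g at *
  have h₁ : T * g ≤ T * (ni + no) * g :=
    Nat.mul_le_mul_right _ (Nat.le_mul_of_pos_right _ hN)
  have h₂ : T * (ni + no) ≤ T * (ni + no) * g := Nat.le_mul_of_pos_right _ hg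
  have h₃ : (ni + 1) * (T * m) ≤ 2 * m * (T * (ni + no) * g) := calc
    (ni + 1) * (T * m) ≤ (2 * (ni + no)) * (T * m) := Nat.mul_le_mul_right _ (by omega)
    _ = 2 * m * (T * (ni + no)) := by ring
    _ ≤ _ := Nat.mul_le_mul_left _ h₂
  have h₄ : ni * (T * m) ≤ m * (T * (ni + no) * g) := calc
    ni * (T * m) ≤ (ni + no) * (T * m) := Nat.mul_le_mul_right _ (by omega)
    _ = m * (T * (ni + no)) := by ring
    _ ≤ _ := Nat.mul_le_mul_left _ h₂
  linarith

/-! ### Cost of the two subproblems in terms of `n` and `p`. -/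

lemma sdpSubproblem_ipmOps_le {T m nx nu nd γ ni no : ℕ} (D : LocalData T m nx nu nd ni no)
    (s : SdpRound T nx nu γ ni)
    (R₀ : Matrix (Fin (Fintype.card (SdpVar T nx nu γ ni no)))
      (Fin (Fintype.card (SdpVar T nx nu γ ni no))) ℝ) (θ : ℝ)
    (x₀ : Fin (Fintype.card (SdpVar T nx nu γ ni no)) → ℝ) (t₀ : ℝ) (L : ℕ)
    {n p : ℕ} (hn₁ : 1 ≤ Fintype.card (SdpVar T nx nu γ ni no))
    (hn : Fintype.card (SdpVar T nx nu γ ni no) ≤ n) (hN : 1 ≤ T * (ni + no))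
    -- A neighbor block has size `2 (nx + T nd) + 1`, and `ConeBlock.cost` involves the size plus
    -- one.
    (hp : 2 * (nx + T * nd) + 2 ≤ p) :
    (sdpSubproblem D s).ipmOps R₀ θ x₀ t₀ L ≤
      L * (200 * (T * (ni + no) * (n ^ 2 * p ^ 2 + n * p ^ 3))) := by
  refine (ConicData.ops_ipmRun_le hn₁ _ _ _ _ _).trans (Nat.mul_le_mul_left _ ?_)
  simp only [ConicProblem.toData, sdpSubproblem, List.map_append, List.map_map, Function.comp_def,
    ConeBlock.cost, linConstraint, psdConstraint, List.map_const', List.sum_append,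
    List.sum_replicate, Finset.length_toList, Finset.card_univ, smul_eq_mul]
  generalize Fintype.card (SdpVar T nx nu γ ni no) = n' at hn ⊢
  simp only [Fintype.card_prod, Fintype.card_sum, Fintype.card_fin, Fintype.card_unit, zero_add,
    mul_one]
  have hn₂ : n' ^ 2 ≤ n ^ 2 := Nat.pow_le_pow_left hn 2
  have hX : n' ^ 2 ≤ n ^ 2 * p ^ 2 + n * p ^ 3 :=
    (hn₂.trans (Nat.le_mul_of_pos_right _ (Nat.pow_pos (by omega)))).trans (Nat.le_add_right _ _)
  have hq : ∀ q ≤ p, n' ^ 2 * q ^ 2 + n' * q ^ 3 ≤ n ^ 2 * p ^ 2 + n * p ^ 3 := fun q hq => by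
    gcongr
  have h₁ := hq (nx + T * nd + 1 + 1) (by omega)
  have h₂ := hq (nx + T * nd + (nx + T * nd) + 1 + 1) (by omega)
  generalize n ^ 2 * p ^ 2 + n * p ^ 3 = X at *
  calc
    -- The three groups are the work outside the blocks, the inequalities `β ≥ 0`, and the matrix
    -- inequalities; `200 = 40 + 80 + 80`.
    _ ≤ 40 * (T * (ni + no) * X) + (T * (no + ni) * (80 * X) +
          (T * no * (80 * X) + T * ni * (80 * X))) := by
      gcongr
      exact hX.trans (Nat.le_mul_of_pos_left _ hN)
    _ = _ := by ring

lemma socpSubproblem_ipmOps_le {T m nx nu nd γ ni no : ℕ} (D : LocalData T m nx nu nd ni no)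
    (s : SocpRound T m ni)
    (R₀ : Matrix (Fin (Fintype.card (SocpVar T m nx nu γ ni no)))
      (Fin (Fintype.card (SocpVar T m nx nu γ ni no))) ℝ) (θ : ℝ)
    (x₀ : Fin (Fintype.card (SocpVar T m nx nu γ ni no)) → ℝ) (t₀ : ℝ) (L : ℕ)
    {n p : ℕ} (hn₁ : 1 ≤ Fintype.card (SocpVar T m nx nu γ ni no))
    (hn : Fintype.card (SocpVar T m nx nu γ ni no) ≤ n) (hN : 1 ≤ T * (ni + no))
    (hp : nx + T * nd + 1 ≤ p) :
    (socpSubproblem D s).ipmOps R₀ θ x₀ t₀ L ≤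
      L * (300 * (m + 1) * (T * (ni + no) * (n ^ 2 * p))) := by
  refine (ConicData.ops_ipmRun_le hn₁ _ _ _ _ _).trans (Nat.mul_le_mul_left _ ?_)
  simp only [ConicProblem.toData, socpSubproblem, List.map_append, List.map_map,
    Function.comp_def, List.map_nil, List.append_nil,
    ConeBlock.cost, linConstraint, socConstraint, List.map_const', List.sum_append,
    List.sum_replicate, Finset.length_toList, Finset.card_univ, smul_eq_mul]
  generalize Fintype.card (SocpVar T m nx nu γ ni no) = n' at hn ⊢
  simp only [Fintype.card_prod, Fintype.card_sum, Fintype.card_fin, zero_add, mul_one]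
  have hn₂ : n' ^ 2 ≤ n ^ 2 := Nat.pow_le_pow_left hn 2
  have hX : n' ^ 2 ≤ n ^ 2 * p := hn₂.trans (Nat.le_mul_of_pos_right _ (by omega))
  have hY : n' ^ 2 * (nx + T * nd + 1) ≤ n ^ 2 * p := Nat.mul_le_mul hn₂ hp
  generalize n ^ 2 * p = X at *
  -- The `T m` large cones do not depend on the neighbors or obstacles; a factor `ni + no` is given
  -- away to match the other groups.
  have hm : T * m ≤ T * (ni + no) * m := by
    gcongr
    exact Nat.le_mul_of_pos_right _ (Nat.pos_of_mul_pos_left hN)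
  calc
    _ ≤ 40 * (T * (ni + no) * X) + (T * no * (80 * X) + T * ni * (80 * X) +
          T * no * (80 * (X * (m + 1))) + T * ni * (80 * (X * (m + 1))) +
          T * (ni + no) * m * (80 * X)) := by
      gcongr
      exact hX.trans (Nat.le_mul_of_pos_left _ hN)
    _ = (40 + 80 + 80 * (m + 1) + 80 * m) * (T * (ni + no) * X) := by ring
    _ ≤ _ := by
      gcongr
      omega

/-! ### Substitution of the dimensions. -/

theorem proposition4 :
    (∀ κ : ℝ, ∃ C : ℝ, ∀ T m nx nu nd γ ni no : ℕ,
      1 ≤ T → 1 ≤ nx → 1 ≤ nu → 1 ≤ nd → 1 ≤ γ → 1 ≤ ni + no →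
      (nx : ℝ) ≤ κ * (T * nd) → (nd : ℝ) ≤ κ * ((ni + no) * nu * nx * γ) →
      ∀ (D : LocalData T m nx nu nd ni no) (s : SdpRound T nx nu γ ni)
        (R₀ : Matrix (Fin (Fintype.card (SdpVar T nx nu γ ni no)))
          (Fin (Fintype.card (SdpVar T nx nu γ ni no))) ℝ),
        (sdpSubproblem (no := no) D s).IsFactor R₀ →
        ∀ (θ : ℝ) (x₀ : Fin (Fintype.card (SdpVar T nx nu γ ni no)) → ℝ) (t₀ : ℝ) (L : ℕ),
          ((sdpSubproblem D s).ipmOps R₀ θ x₀ t₀ L : ℝ) ≤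
            C * (L * T ^ 5 * (ni + no) ^ 3 * nu ^ 2 * nx ^ 2 * nd ^ 2 * γ ^ 2)) ∧
    (∀ (m : ℕ) (κ : ℝ), ∃ C : ℝ, ∀ T nx nu nd γ ni no : ℕ,
      1 ≤ T → 1 ≤ nx → 1 ≤ nu → 1 ≤ nd → 1 ≤ γ → 1 ≤ ni + no →
      (nx : ℝ) ≤ κ * (T * nd) →
      ∀ (D : LocalData T m nx nu nd ni no) (s : SocpRound T m ni)
        (R₀ : Matrix (Fin (Fintype.card (SocpVar T m nx nu γ ni no)))
          (Fin (Fintype.card (SocpVar T m nx nu γ ni no))) ℝ),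
        (socpSubproblem (γ := γ) D s).IsFactor R₀ →
        ∀ (θ : ℝ) (x₀ : Fin (Fintype.card (SocpVar T m nx nu γ ni no)) → ℝ) (t₀ : ℝ) (L : ℕ),
          ((socpSubproblem D s).ipmOps R₀ θ x₀ t₀ L : ℝ) ≤
            C * (L * T ^ 4 * (ni + no) ^ 3 * nu ^ 2 * nx ^ 2 * nd * γ ^ 2)) := by

  refine ⟨fun κ => ⟨200 * ((25 + 5 * (κ * (2 * κ + 4))) * (2 * κ + 4) ^ 2), ?_⟩,
    fun m κ => ⟨300 * (m + 1) * ((3 * m + 3) ^ 2 * (κ + 2)), ?_⟩⟩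
  · intro T m nx nu nd γ ni no hT hx hu hd hγ hN hκ hκ' D s R₀ _ θ x₀ t₀ L
    have hg : 1 ≤ nu * nx * γ := Nat.mul_pos (Nat.mul_pos hu hx) hγ
    have hTd : 1 ≤ T * nd := Nat.mul_pos hT hd
    have hTN : 1 ≤ T * (ni + no) := Nat.mul_pos hT hN
    have hn₁ : 1 ≤ Fintype.card (SdpVar T nx nu γ ni no) :=
      Fintype.card_pos_iff.2 ⟨.inl (none, .inl (⟨0, hT⟩, ⟨0, hu⟩))⟩
    have key := sdpSubproblem_ipmOps_le D s R₀ θ x₀ t₀ L hn₁ (card_sdpVar_le hx hu hγ hN) hTN le_rfl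
    -- `κ` ranges over all reals, but `1 ≤ nx ≤ κ T nd` forces its sign.
    have hκ₀ : 0 ≤ κ := by
      by_contra! h
      have : (1 : ℝ) ≤ nx := by exact_mod_cast hx
      have : κ * (T * nd : ℝ) ≤ 0 := mul_nonpos_of_nonpos_of_nonneg h.le (by positivity)
      linarith
    have hp : ((2 * (nx + T * nd) + 2 : ℕ) : ℝ) ≤ (2 * κ + 4) * (T * nd) := by
      have : (1 : ℝ) ≤ T * nd := by exact_mod_cast hTd
      push_cast
      linarith
    -- This is where the hypothesis on `nd` enters: the cone size is at most a constant times the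
    -- bound on the number of variables.
    have hp' : (2 * κ + 4) * (T * nd) ≤
        (κ * (2 * κ + 4)) * (T * (ni + no) * (nu * nx * γ) : ℝ) := calc
      (2 * κ + 4) * (T * nd) ≤ (2 * κ + 4) * (T * (κ * ((ni + no) * nu * nx * γ))) := by gcongr
      _ = _ := by ring
    generalize 2 * (nx + T * nd) + 2 = p at key hp
    have key' : ((sdpSubproblem D s).ipmOps R₀ θ x₀ t₀ L : ℝ) ≤ L * (200 * (T * (ni + no) *
        ((5 * (T * (ni + no) * (nu * nx * γ))) ^ 2 * p ^ 2 +
          (5 * (T * (ni + no) * (nu * nx * γ))) * p ^ 3))) := by exact_mod_cast key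
    refine key'.trans ?_
    set a : ℝ := T * (ni + no) * (nu * nx * γ) with ha
    set P : ℝ := (2 * κ + 4) * (T * nd) with hP
    have ha₀ : 0 ≤ a := by positivity
    calc
      _ ≤ L * (200 * (T * (ni + no) * ((5 * a) ^ 2 * P ^ 2 +
            (5 * a) * (P ^ 2 * (κ * (2 * κ + 4) * a))))) := by
        -- In `p³ = p² p`, the square is bounded by `P²` and the last factor by a multiple of `a`,
        -- so both terms become multiples of `a² P²`. This yields `25 + 5 κ (2 κ + 4)` in the
        -- constant.
        rw [pow_succ (p : ℝ) 2]
        gcongr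
        exact hp.trans hp'
      _ = _ := by
        rw [ha, hP]
        ring
  · intro T nx nu nd γ ni no hT hx hu hd hγ hN hκ D s R₀ _ θ x₀ t₀ L
    have hTd : 1 ≤ T * nd := Nat.mul_pos hT hd
    have hTN : 1 ≤ T * (ni + no) := Nat.mul_pos hT hN
    have hn₁ : 1 ≤ Fintype.card (SocpVar T m nx nu γ ni no) :=
      Fintype.card_pos_iff.2 ⟨.inl (.inl (⟨0, hT⟩, ⟨0, hu⟩))⟩
    have key := socpSubproblem_ipmOps_le D s R₀ θ x₀ t₀ L hn₁ (card_socpVar_le hx hu hγ hN) hTN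
      le_rfl
    have hp : ((nx + T * nd + 1 : ℕ) : ℝ) ≤ (κ + 2) * (T * nd) := by
      have : (1 : ℝ) ≤ T * nd := by exact_mod_cast hTd
      push_cast
      linarith
    generalize nx + T * nd + 1 = p at key hp
    have key' : ((socpSubproblem D s).ipmOps R₀ θ x₀ t₀ L : ℝ) ≤ L * (300 * (m + 1) *
        (T * (ni + no) * (((3 * m + 3) * (T * (ni + no) * (nu * nx * γ))) ^ 2 * p))) := by
      exact_mod_cast key
    refine key'.trans ?_
    calc
      _ ≤ L * (300 * (m + 1) * (T * (ni + no) *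
          (((3 * m + 3) * (T * (ni + no) * (nu * nx * γ))) ^ 2 * ((κ + 2) * (T * nd) : ℝ)))) := by
        gcongr
      _ = _ := by ring
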